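/- Let $\xi_1,\xi_2,\dots$ be independent, identically distributed random variables with values in $\mathbb N=\{1,2,3,\dots\}$ (almost surely), and suppose that the truncated mean $\ell(t):=\mathbb E(\xi_1\wedge t)$ is slowly varying at infinity, i.e. $\ell(ct)/\ell(t)\to1$ as $t\to\infty$ for every $c>0$. Put $s_k:=\sum_{i=1}^k\xi_i$, $u(n):=\sum_{k=1}^nP(s_k=n)$ and $a(n):=\sum_{k=1}^nu(k)$ for $k,n\ge1$. Then $$a(n)\sim\frac n{\ell(n)}\qquad(n\to\infty),$$ that is, the ratio of the two sides tends to $1$; and for every bounded continuous function $g:(0,\infty)\to\mathbb R$, $$\frac1{a(N)}\sum_{n=1}^N\Bigl|\sum_{k=1}^ng\Bigl(\frac k{a(n)}\Bigr)P(s_k=n)-g(1)u(n)\Bigr|\xrightarrow[N\to\infty]{}0.$$ (If $a(n)=0$, then $P(s_k=n)=0$ for all $k\ge1$, and the corresponding summand is read as $0$.) -/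

import Mathlib

open MeasureTheory ProbabilityTheory Filter Topology Asymptotics

/-- A real function `f` is slowly varying at infinity (Karamata): on some half-line `[A, ∞)` it is
positive and measurable, and `f (c * t) / f t → 1` as `t → ∞`, for every `c > 0`. -/
def IsSlowlyVarying (f : ℝ → ℝ) : Prop :=
  (∃ A : ℝ, Measurable (fun t : Set.Ici A => f t) ∧ ∀ t, A ≤ t → 0 < f t) ∧
    ∀ c : ℝ, 0 < c → Tendsto (fun t : ℝ => f (c * t) / f t) atTop (𝓝 1)

namespace Renewal

variable {Ω : Type*} [MeasurableSpace Ω]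

/-- The truncated mean `t ↦ E (X ∧ t)` of an `ℕ`-valued random variable `X`. -/
noncomputable def truncatedMean (P : Measure Ω) (X : Ω → ℕ) (t : ℝ) : ℝ :=
  ∫ ω, min (X ω : ℝ) t ∂P

/-- The sum `s_k` of the first `k` lifetimes; the lifetimes are indexed from `0`. -/
def partialSum (ξ : ℕ → Ω → ℕ) (k : ℕ) (ω : Ω) : ℕ :=
  ∑ i ∈ Finset.range k, ξ i ω

/-- The probability `P (s_k = n)`. -/
noncomputable def hitProb (P : Measure Ω) (ξ : ℕ → Ω → ℕ) (k n : ℕ) : ℝ :=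
  P.real {ω | partialSum ξ k ω = n}

/-- The renewal sequence `u(n) = ∑_{k=1}^n P (s_k = n)`. -/
noncomputable def renewalSeq (P : Measure Ω) (ξ : ℕ → Ω → ℕ) (n : ℕ) : ℝ :=
  ∑ k ∈ Finset.Icc 1 n, hitProb P ξ k n

/-- The return sequence `a(n) = ∑_{k=1}^n u(k)`. -/
noncomputable def returnSeq (P : Measure Ω) (ξ : ℕ → Ω → ℕ) (n : ℕ) : ℝ :=
  ∑ k ∈ Finset.Icc 1 n, renewalSeq P ξ k

end Renewal

/-! Let `F` be the generating series of the law of ξ₁ and L its truncated mean at integers. Since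
`(1 - F)⁻¹ · (1 - F)/(1 - X)² = 1/(1 - X)²`, the renewal masses convolved with L give n + 1
(`sum_coeff_inv_mul_tailSum`). As L is monotone, n ≤ (1 + a(n)) L(n) and (1 + a(n)) L(m + 1) ≤ n + m
+ 1. Taking m ≈ εn, slow variation yields a(n) ~ n/ℓ(n).

For the second claim, a(n) is the sum over k of the weights P(s_k ≤ n) ∈ [0, 1]. The first moment of
such weights is at least a(n)²/2, and near equality forces them close to the indicator of k ≤ a(n)
(`sum_tails_le`). Using the upper bound twice shows that the moment is at most (1/2 + o(1)) a(n)²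
(`tendsto_moment_gap`).

Summing P(s_k = n) over M < n ≤ N telescopes to P(s_k ≤ N) - P(s_k ≤ M). With M ≈ (1 - δ/4)N, the
mass on this block carried by k far from a(n) is therefore o(a(N)) (`sum_Ioc_deviantMass_le`). Since
a(M)/a(N) → 1 - δ/4 < 1, the block bound is a contraction and extends to all n ≤ N
(`tendsto_zero_of_contraction`). Only the values of g near 1 then matter. -/

namespace Renewal

/-! ### Renewal identities and inequalities for formal power series -/

open PowerSeries Finset

/-- The renewal sequence of a lifetime distribution with generating series `F`. -/
noncomputable def seriesRenewal (F : ℝ⟦X⟧) (n : ℕ) : ℝ :=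
  ∑ k ∈ Icc 1 n, coeff n (F ^ k)

/-- The return sequence of a lifetime distribution with generating series `F`. -/
noncomputable def seriesReturn (F : ℝ⟦X⟧) (n : ℕ) : ℝ :=
  ∑ k ∈ Icc 1 n, seriesRenewal F k

/-- The mass that the `k`-fold convolution power gives to `{0, …, n}`. -/
noncomputable def seriesDist (F : ℝ⟦X⟧) (k n : ℕ) : ℝ :=
  ∑ i ∈ range (n + 1), coeff i (F ^ k)

/-- The truncated mean at an integer, as a sum of tails. -/
noncomputable def tailSum (F : ℝ⟦X⟧) (n : ℕ) : ℝ :=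
  ∑ m ∈ range n, (1 - ∑ i ∈ range (m + 1), coeff i F)

/-- The series `∑ Xⁿ`; multiplying by it forms partial sums of coefficients. -/
noncomputable def allOnes : ℝ⟦X⟧ := PowerSeries.mk 1

lemma coeff_mul_allOnes (φ : ℝ⟦X⟧) (n : ℕ) :
    coeff n (φ * allOnes) = ∑ i ∈ range (n + 1), coeff i φ := by
  rw [coeff_mul, Nat.sum_antidiagonal_eq_sum_range_succ_mk]
  simp [allOnes]

lemma coeff_allOnes (n : ℕ) : coeff n allOnes = 1 := by simp [allOnes]

variable {F : ℝ⟦X⟧}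

lemma coeff_pow_eq_zero (h0 : constantCoeff F = 0) {n k : ℕ} (h : n < k) (φ : ℝ⟦X⟧) :
    coeff n (F ^ k * φ) = 0 := by
  have : (X : ℝ⟦X⟧) ^ k ∣ F ^ k * φ :=
    Dvd.dvd.mul_right (pow_dvd_pow_of_dvd (X_dvd_iff.2 h0) k) φ
  exact X_pow_dvd_iff.1 this n h

lemma coeff_pow_nonneg (h : ∀ n, 0 ≤ coeff n F) (k n : ℕ) : 0 ≤ coeff n (F ^ k) := by
  induction k generalizing n with
  | zero => rw [pow_zero, coeff_one]; split_ifs <;> norm_num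
  | succ k ih =>
    rw [pow_succ, coeff_mul]
    exact sum_nonneg fun p _ => mul_nonneg (ih _) (h _)

lemma one_sub_mul_inv (h0 : constantCoeff F = 0) : (1 - F) * (1 - F)⁻¹ = 1 :=
  PowerSeries.mul_inv_cancel _ (by simp [h0])

lemma sum_pow_range (h0 : constantCoeff F = 0) (n : ℕ) :
    ∑ k ∈ range n, F ^ k = (1 - F)⁻¹ - F ^ n * (1 - F)⁻¹ := by
  have h1 := mul_neg_geom_sum F n
  have h2 := one_sub_mul_inv h0
  calc ∑ k ∈ range n, F ^ k = ((1 - F) * (1 - F)⁻¹) * ∑ k ∈ range n, F ^ k := by rw [h2, one_mul]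
    _ = ((1 - F) * ∑ k ∈ range n, F ^ k) * (1 - F)⁻¹ := by ring
    _ = _ := by rw [h1]; ring

lemma sum_range_coeff_pow (h0 : constantCoeff F = 0) (φ : ℝ⟦X⟧) {m n : ℕ} (h : m < n) :
    ∑ k ∈ range n, coeff m (F ^ k * φ) = coeff m ((1 - F)⁻¹ * φ) := by
  rw [← map_sum, ← sum_mul, sum_pow_range h0, sub_mul, map_sub, mul_assoc,
    coeff_pow_eq_zero h0 h, sub_zero]

lemma sum_Icc_eq_range (f : ℕ → ℝ) (n : ℕ) :
    ∑ k ∈ Icc 1 n, f k = ∑ k ∈ range (n + 1), f k - f 0 := by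
  rw [range_eq_Ico, sum_eq_sum_Ico_succ_bot (by omega : 0 < n + 1)]
  rw [add_sub_cancel_left]
  rfl

lemma seriesRenewal_eq (h0 : constantCoeff F = 0) (n : ℕ) :
    seriesRenewal F n = coeff n ((1 - F)⁻¹ - 1) := by
  have h := sum_range_coeff_pow h0 1 (Nat.lt_succ_self n)
  simp only [mul_one] at h
  rw [seriesRenewal, sum_Icc_eq_range, h, pow_zero, map_sub]

lemma seriesRenewal_zero (F : ℝ⟦X⟧) : seriesRenewal F 0 = 0 := by simp [seriesRenewal]

lemma seriesReturn_eq_range (F : ℝ⟦X⟧) (n : ℕ) :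
    seriesReturn F n = ∑ k ∈ range (n + 1), seriesRenewal F k := by
  rw [seriesReturn, sum_Icc_eq_range, seriesRenewal_zero, sub_zero]

/-- The extra 1 is the renewal at time 0, the term `k = 0` of the geometric series. -/
lemma seriesReturn_eq (h0 : constantCoeff F = 0) (n : ℕ) :
    1 + seriesReturn F n = coeff n ((1 - F)⁻¹ * allOnes) := by
  rw [seriesReturn_eq_range]
  simp_rw [seriesRenewal_eq h0]
  rw [← coeff_mul_allOnes, sub_mul, map_sub, one_mul, coeff_allOnes]
  ring

lemma tailSum_eq (n : ℕ) : tailSum F (n + 1) = coeff n ((1 - F) * allOnes * allOnes) := by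
  rw [coeff_mul_allOnes, tailSum]
  refine sum_congr rfl fun m _ => ?_
  rw [sub_mul, map_sub, one_mul, coeff_allOnes, coeff_mul_allOnes]

lemma seriesRenewal_nonneg (h : ∀ n, 0 ≤ coeff n F) (n : ℕ) : 0 ≤ seriesRenewal F n :=
  sum_nonneg fun _ _ => coeff_pow_nonneg h _ _

lemma seriesReturn_nonneg (h : ∀ n, 0 ≤ coeff n F) (n : ℕ) : 0 ≤ seriesReturn F n :=
  sum_nonneg fun _ _ => seriesRenewal_nonneg h _

lemma seriesReturn_mono (h : ∀ n, 0 ≤ coeff n F) : Monotone (seriesReturn F) := by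
  intro m n hmn
  exact sum_le_sum_of_subset_of_nonneg (Icc_subset_Icc_right hmn)
    fun _ _ _ => seriesRenewal_nonneg h _

lemma tailSum_mono (h1 : ∀ n, ∑ i ∈ range n, coeff i F ≤ 1) : Monotone (tailSum F) := by
  intro m n hmn
  exact sum_le_sum_of_subset_of_nonneg (range_mono hmn)
    fun i _ _ => sub_nonneg.2 (h1 _)

lemma coeff_inv_nonneg (h0 : constantCoeff F = 0) (h : ∀ n, 0 ≤ coeff n F) (n : ℕ) :
    0 ≤ coeff n (1 - F)⁻¹ := by
  have h2 := sum_range_coeff_pow h0 1 (Nat.lt_succ_self n)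
  simp only [mul_one] at h2
  rw [← h2]
  exact sum_nonneg fun _ _ => coeff_pow_nonneg h _ _

/-- The renewal equation, integrated twice. -/
lemma sum_coeff_inv_mul_tailSum (h0 : constantCoeff F = 0) (n : ℕ) :
    ∑ j ∈ range (n + 1), coeff j (1 - F)⁻¹ * tailSum F (n - j + 1) = n + 1 := by
  have h2 : (1 - F)⁻¹ * ((1 - F) * allOnes * allOnes) = allOnes * allOnes := by
    linear_combination (allOnes * allOnes) * one_sub_mul_inv h0
  have h3 := congrArg (coeff n) h2
  rw [coeff_mul, Nat.sum_antidiagonal_eq_sum_range_succ_mk, coeff_mul_allOnes] at h3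
  simp_rw [tailSum_eq]
  rw [h3]
  simp [coeff_allOnes]

lemma one_add_seriesReturn_eq_range (h0 : constantCoeff F = 0) (n : ℕ) :
    1 + seriesReturn F n = ∑ j ∈ range (n + 1), coeff j (1 - F)⁻¹ := by
  rw [seriesReturn_eq h0, coeff_mul_allOnes]

lemma seriesReturn_lower (h0 : constantCoeff F = 0) (h : ∀ n, 0 ≤ coeff n F)
    (h1 : ∀ n, ∑ i ∈ range n, coeff i F ≤ 1) (n : ℕ) :
    (n : ℝ) ≤ (1 + seriesReturn F n) * tailSum F n := by
  have hL : ∀ m, 0 ≤ tailSum F m := fun m => sum_nonneg fun i _ => sub_nonneg.2 (h1 _)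
  cases n with
  | zero => simp [tailSum]
  | succ n =>
    calc ((n + 1 : ℕ) : ℝ) = ∑ j ∈ range (n + 1), coeff j (1 - F)⁻¹ * tailSum F (n - j + 1) := by
          rw [sum_coeff_inv_mul_tailSum h0]; push_cast; ring
      _ ≤ ∑ j ∈ range (n + 1), coeff j (1 - F)⁻¹ * tailSum F (n + 1) :=
          sum_le_sum fun j _ => mul_le_mul_of_nonneg_left (tailSum_mono h1 (by omega))
            (coeff_inv_nonneg h0 h j)
      _ = (1 + seriesReturn F n) * tailSum F (n + 1) := by
          rw [← sum_mul, one_add_seriesReturn_eq_range h0]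
      _ ≤ _ := by
          gcongr
          · exact hL _
          · exact seriesReturn_mono h (Nat.le_succ n)

/-- In the renewal equation at `n + m`, drop the terms `j > n`; in the others the truncation level
is at least `m + 1`. -/
lemma seriesReturn_upper (h0 : constantCoeff F = 0) (h : ∀ n, 0 ≤ coeff n F)
    (h1 : ∀ n, ∑ i ∈ range n, coeff i F ≤ 1) (n m : ℕ) :
    (1 + seriesReturn F n) * tailSum F (m + 1) ≤ n + m + 1 := by
  have hL : ∀ m, 0 ≤ tailSum F m := fun m => sum_nonneg fun i _ => sub_nonneg.2 (h1 _)
  calc (1 + seriesReturn F n) * tailSum F (m + 1)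
      = ∑ j ∈ range (n + 1), coeff j (1 - F)⁻¹ * tailSum F (m + 1) := by
        rw [← sum_mul, one_add_seriesReturn_eq_range h0]
    _ ≤ ∑ j ∈ range (n + 1), coeff j (1 - F)⁻¹ * tailSum F (n + m - j + 1) := by
        refine sum_le_sum fun j hj => mul_le_mul_of_nonneg_left (tailSum_mono h1 ?_)
            (coeff_inv_nonneg h0 h j)
        have := mem_range.1 hj
        omega
    _ ≤ ∑ j ∈ range (n + m + 1), coeff j (1 - F)⁻¹ * tailSum F (n + m - j + 1) :=
        sum_le_sum_of_subset_of_nonneg (range_mono (by omega))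
          fun j _ _ => mul_nonneg (coeff_inv_nonneg h0 h j) (hL _)
    _ = n + m + 1 := by rw [sum_coeff_inv_mul_tailSum h0]; push_cast; ring

lemma seriesDist_eq (F : ℝ⟦X⟧) (k n : ℕ) : seriesDist F k n = coeff n (F ^ k * allOnes) := by
  rw [coeff_mul_allOnes, seriesDist]

lemma seriesReturn_eq_sum_dist (h0 : constantCoeff F = 0) (n : ℕ) :
    seriesReturn F n = ∑ k ∈ Icc 1 n, seriesDist F k n := by
  simp_rw [seriesDist_eq]
  rw [sum_Icc_eq_range, sum_range_coeff_pow h0 _ (Nat.lt_succ_self n), ← seriesReturn_eq h0]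
  simp [coeff_allOnes]

/-- The sum of `k` times the mass of `{0, …, n}` under the `k`-th convolution power is a
convolution of the renewal sequence with its partial sums. -/
lemma sum_mul_seriesDist (h0 : constantCoeff F = 0) (n : ℕ) :
    ∑ k ∈ Icc 1 n, (k : ℝ) * seriesDist F k n =
      ∑ j ∈ range (n + 1), seriesRenewal F j * (1 + seriesReturn F (n - j)) := by
  -- The geometric tail from `F ^ i` on; powers above `n` do not reach degree `n`.
  have hin : ∀ i ∈ Icc 1 n, ∑ k ∈ Icc i n, seriesDist F k n =
      coeff n (F ^ i * ((1 - F)⁻¹ * allOnes)) := by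
    intro i hi
    have hi' := mem_Icc.1 hi
    have e : F ^ i * ((1 - F)⁻¹ * allOnes) = (1 - F)⁻¹ * (F ^ i * allOnes) := by ring
    rw [e, ← sum_range_coeff_pow h0 _ (Nat.lt_succ_self n)]
    rw [← sum_subset (range_mono (by omega : n + 1 - i ≤ n + 1))]
    · have : Icc i n = Ico i (n + 1) := rfl
      rw [this, sum_Ico_eq_sum_range]
      refine sum_congr rfl fun k _ => ?_
      rw [seriesDist_eq, pow_add]
      congr 1; ring
    · intro k _ hk
      rw [← mul_assoc, ← pow_add]
      exact coeff_pow_eq_zero h0 (by simp at hk; omega) _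
  -- Write `k` as a sum of `k` ones and exchange the sums.
  have hl : ∑ k ∈ Icc 1 n, (k : ℝ) * seriesDist F k n =
      ∑ i ∈ Icc 1 n, ∑ k ∈ Icc i n, seriesDist F k n := by
    rw [sum_comm' (t' := Icc 1 n) (s' := fun k => Icc 1 k)
      (by intro x y; simp only [mem_Icc]; omega)]
    refine sum_congr rfl fun k _ => ?_
    simp
  rw [hl, sum_congr rfl hin, sum_Icc_eq_range, sum_range_coeff_pow h0 _ (Nat.lt_succ_self n)]
  have e : (1 - F)⁻¹ * ((1 - F)⁻¹ * allOnes) - F ^ 0 * ((1 - F)⁻¹ * allOnes)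
      = ((1 - F)⁻¹ - 1) * ((1 - F)⁻¹ * allOnes) := by ring
  rw [← map_sub, e, coeff_mul, Nat.sum_antidiagonal_eq_sum_range_succ_mk]
  refine sum_congr rfl fun j _ => ?_
  rw [seriesRenewal_eq h0, seriesReturn_eq h0]

lemma sum_seriesRenewal_mul (F : ℝ⟦X⟧) (n : ℕ) :
    ∑ j ∈ range (n + 1), seriesRenewal F j * ((n : ℝ) - j) = ∑ i ∈ range n, seriesReturn F i := by
  induction n with
  | zero => simp
  | succ n ih =>
    rw [sum_range_succ, sum_range_succ (seriesReturn F), ← ih, seriesReturn_eq_range,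
      ← sum_add_distrib]
    simp only [sub_self, mul_zero, add_zero]
    refine sum_congr rfl fun j _ => ?_
    push_cast; ring

/-- The hypothesis `hup` is used once for each factor of the convolution, with summation by parts in
between. In the application `b = ℓ t` and `c = t + 1` with `t = ε n`, so that `c` is a small
multiple of `n`. -/
lemma sum_mul_seriesDist_le (h0 : constantCoeff F = 0) (h : ∀ n, 0 ≤ coeff n F) {b c : ℝ}
    (hb : 0 ≤ b) (hc : 0 ≤ c) (hup : ∀ n : ℕ, (1 + seriesReturn F n) * b ≤ n + c) (n : ℕ) :
    (∑ k ∈ Icc 1 n, (k : ℝ) * seriesDist F k n) * b ^ 2 ≤ (n : ℝ) ^ 2 / 2 + 2 * n * c + c ^ 2 := by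
  have hup' : ∀ n : ℕ, seriesReturn F n * b ≤ n + c := fun n => by nlinarith [hup n]
  have hs : ∀ n : ℕ, ∑ i ∈ range n, (i : ℝ) ≤ (n : ℝ) ^ 2 / 2 := by
    intro n
    induction n with
    | zero => simp
    | succ n ih => rw [sum_range_succ]; push_cast; nlinarith
  have e1 : (∑ k ∈ Icc 1 n, (k : ℝ) * seriesDist F k n) * b ≤
      (∑ i ∈ range n, seriesReturn F i) + c * seriesReturn F n := by
    rw [sum_mul_seriesDist h0, ← sum_seriesRenewal_mul, seriesReturn_eq_range F n, mul_sum,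
      ← sum_add_distrib, sum_mul]
    refine sum_le_sum fun j hj => ?_
    have hjn : j ≤ n := by have := mem_range.1 hj; omega
    have := mul_le_mul_of_nonneg_left (hup (n - j)) (seriesRenewal_nonneg h j)
    rw [Nat.cast_sub hjn] at this
    linarith
  have e2 : (∑ i ∈ range n, seriesReturn F i) * b ≤ (n : ℝ) ^ 2 / 2 + n * c := by
    rw [sum_mul]
    calc ∑ i ∈ range n, seriesReturn F i * b ≤ ∑ i ∈ range n, ((i : ℝ) + c) :=
          sum_le_sum fun i _ => hup' i
      _ ≤ _ := by rw [sum_add_distrib]; simp only [sum_const, card_range, nsmul_eq_mul]; linarith [hs n]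
  have e3 := mul_le_mul_of_nonneg_left (hup' n) hc
  have e4 := mul_le_mul_of_nonneg_right e1 hb
  nlinarith

/-- Weights in `[0, 1]` whose first moment is almost minimal, given their sum, concentrate on an
initial segment. -/
lemma sum_tails_le {p : ℕ → ℝ} {N : ℕ} {A η : ℝ} (hp0 : ∀ k, 0 ≤ p k) (hp1 : ∀ k, p k ≤ 1)
    (hA : ∑ k ∈ Icc 1 N, p k = A) (hη : 0 ≤ η) :
    (∑ k ∈ (Icc 1 N).filter fun k : ℕ =>  (k : ℝ) ≤ (1 - η) * A, (1 - p k)) * (η * A) +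
      (∑ k ∈ (Icc 1 N).filter fun k : ℕ =>  (1 + η) * A < (k : ℝ), p k) * (η * A) ≤
      ∑ k ∈ Icc 1 N, (k : ℝ) * p k - A ^ 2 / 2 := by
  have hA0 : 0 ≤ A := hA ▸ sum_nonneg fun k _ => hp0 k
  have hηA : 0 ≤ η * A := mul_nonneg hη hA0
  have key : ∑ k ∈ (Icc 1 N).filter fun k : ℕ =>  (k : ℝ) ≤ A, (A - k) ≤ A ^ 2 / 2 := by
    calc ∑ k ∈ (Icc 1 N).filter fun k : ℕ =>  (k : ℝ) ≤ A, (A - k) ≤ ∑ k ∈ Icc 1 ⌊A⌋₊, (A - k) := by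
          refine sum_le_sum_of_subset_of_nonneg ?_ ?_
          · intro k hk
            simp only [mem_filter, mem_Icc] at hk ⊢
            exact ⟨hk.1.1, Nat.le_floor hk.2⟩
          · intro k hk _
            have := (Nat.le_floor_iff hA0).1 (mem_Icc.1 hk).2
            linarith
      _ ≤ A ^ 2 / 2 := by
          have : ∀ m : ℕ, ∑ k ∈ Icc 1 m, (A - k) = A * m - m * (m + 1) / 2 := by
            intro m
            induction m with
            | zero => simp
            | succ m ih => rw [sum_Icc_succ_top (by omega), ih]; push_cast; ring
          rw [this]
          nlinarith [sq_nonneg (A - (⌊A⌋₊ : ℝ)), Nat.cast_nonneg (α := ℝ) ⌊A⌋₊]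
  -- The summand is `(A - k) (1 - p k)` for `k ≤ A` and `(k - A) p k` beyond: nonnegative, with a
  -- first factor of at least `η A` on the two tails.
  have hsum : ∑ k ∈ Icc 1 N, (((k : ℝ) - A) * p k + if (k : ℝ) ≤ A then A - k else 0) ≤
      ∑ k ∈ Icc 1 N, (k : ℝ) * p k - A ^ 2 / 2 := by
    rw [sum_add_distrib, ← sum_filter]
    have : ∑ k ∈ Icc 1 N, ((k : ℝ) - A) * p k = ∑ k ∈ Icc 1 N, (k : ℝ) * p k - A ^ 2 := by
      simp_rw [sub_mul]
      rw [sum_sub_distrib, ← mul_sum, hA]; ring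
    rw [this]; linarith
  refine le_trans ?_ hsum
  rw [sum_filter, sum_filter, sum_mul, sum_mul, ← sum_add_distrib]
  refine sum_le_sum fun k _ => ?_
  have a0 := hp0 k
  have a1 := hp1 k
  split_ifs <;> nlinarith

end Renewal

/-! ### From random lifetimes to generating series -/

namespace Renewal

section Lifetimes

variable {Ω : Type*} [MeasurableSpace Ω]

/-- The generating series of the law of an `ℕ`-valued random variable. -/
noncomputable def genSeries (P : Measure Ω) (X : Ω → ℕ) : PowerSeries ℝ :=
  PowerSeries.mk fun n => P.real {ω | X ω = n}

variable {P : Measure Ω} {X : Ω → ℕ} {ξ : ℕ → Ω → ℕ}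

lemma coeff_genSeries (n : ℕ) :
    PowerSeries.coeff n (genSeries P X) = P.real {ω | X ω = n} := by
  simp [genSeries]

lemma coeff_genSeries_nonneg (n : ℕ) : 0 ≤ PowerSeries.coeff n (genSeries P X) := by
  rw [coeff_genSeries]; exact measureReal_nonneg

lemma constantCoeff_genSeries (hpos : ∀ᵐ ω ∂P, 1 ≤ X ω) :
    PowerSeries.constantCoeff (genSeries P X) = 0 := by
  rw [← PowerSeries.coeff_zero_eq_constantCoeff_apply, coeff_genSeries, measureReal_def]
  have : P {ω | X ω = 0} = 0 := by
    refine measure_mono_null ?_ (ae_iff.1 hpos)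
    intro ω hω
    simp only [Set.mem_ofPred_eq] at hω ⊢
    omega
  simp [this]

lemma sum_range_real_eq [IsProbabilityMeasure P] (hX : Measurable X) (n : ℕ) :
    ∑ i ∈ Finset.range n, P.real {ω | X ω = i} = P.real {ω | X ω < n} := by
  have h := sum_measureReal_preimage_singleton (μ := P) (f := X) (Finset.range n)
    (fun y _ => hX (measurableSet_singleton y))
  have e : X ⁻¹' ((Finset.range n : Finset ℕ) : Set ℕ) = {ω | X ω < n} := by
    ext ω; simp
  rw [e] at h
  exact h

lemma hitProb_eq_coeff [IsProbabilityMeasure P] (hmeas : ∀ i, Measurable (ξ i))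
    (hindep : iIndepFun ξ P) (hident : ∀ i, IdentDistrib (ξ i) (ξ 0) P P) (k n : ℕ) :
    hitProb P ξ k n = PowerSeries.coeff n (genSeries P (ξ 0) ^ k) := by
  induction k generalizing n with
  | zero =>
    rw [pow_zero, PowerSeries.coeff_one, hitProb]
    by_cases h : n = 0
    · simp [partialSum, h]
    · have : ¬ (0 = n) := fun h' => h h'.symm
      simp [partialSum, h, this]
  | succ k ih =>
    have hps : Measurable (partialSum ξ k) := by
      unfold partialSum
      exact Finset.measurable_sum _ fun i _ => hmeas i
    have hind : IndepFun (partialSum ξ k) (ξ k) P := by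
      have := hindep.indepFun_sum_range_succ hmeas k
      convert this using 1
      ext ω; simp [partialSum]
    rw [pow_succ, PowerSeries.coeff_mul, hitProb]
    have e : {ω | partialSum ξ (k + 1) ω = n} =
        ⋃ p ∈ Finset.HasAntidiagonal.antidiagonal n, partialSum ξ k ⁻¹' {p.1} ∩ ξ k ⁻¹' {p.2} := by
      ext ω
      simp only [Set.mem_ofPred_eq, Set.mem_iUnion, Finset.HasAntidiagonal.mem_antidiagonal, Set.mem_inter_iff,
        Set.mem_preimage, Set.mem_singleton_iff, exists_prop]
      rw [partialSum, Finset.sum_range_succ]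
      constructor
      · intro h
        exact ⟨(_, _), h, rfl, rfl⟩
      · rintro ⟨p, h, h1, h2⟩
        rw [← h, ← h1, ← h2]; rfl
    rw [e, measureReal_biUnion_finset]
    · refine Finset.sum_congr rfl fun p _ => ?_
      rw [← ih, coeff_genSeries, hitProb, measureReal_def,
        hind.measure_inter_preimage_eq_mul _ _ (measurableSet_singleton _)
          (measurableSet_singleton _), (hident k).measure_mem_eq (measurableSet_singleton _),
        ENNReal.toReal_mul]
      rfl
    · intro p _ q _ hpq
      refine Set.disjoint_left.2 fun ω h1 h2 => hpq ?_
      simp only [Set.mem_inter_iff, Set.mem_preimage, Set.mem_singleton_iff] at h1 h2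
      exact Prod.ext (h1.1.symm.trans h2.1) (h1.2.symm.trans h2.2)
    · intro p _
      exact (hps (measurableSet_singleton _)).inter (hmeas k (measurableSet_singleton _))

lemma seriesDist_genSeries_le_one [IsProbabilityMeasure P] (hmeas : ∀ i, Measurable (ξ i))
    (hindep : iIndepFun ξ P) (hident : ∀ i, IdentDistrib (ξ i) (ξ 0) P P) (k n : ℕ) :
    seriesDist (genSeries P (ξ 0)) k n ≤ 1 := by
  have hps : Measurable (partialSum ξ k) := by
    unfold partialSum
    exact Finset.measurable_sum _ fun i _ => hmeas i
  simp_rw [seriesDist, ← hitProb_eq_coeff hmeas hindep hident, hitProb]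
  rw [sum_range_real_eq hps]
  exact measureReal_le_one

lemma sum_coeff_genSeries_le_one [IsProbabilityMeasure P] (hX : Measurable X) (n : ℕ) :
    ∑ i ∈ Finset.range n, PowerSeries.coeff i (genSeries P X) ≤ 1 := by
  simp_rw [coeff_genSeries]
  rw [sum_range_real_eq hX]
  exact measureReal_le_one

lemma abs_min_natCast_le (n : ℕ) (t : ℝ) : |min (n : ℝ) t| ≤ |t| := by
  have : (0 : ℝ) ≤ n := n.cast_nonneg
  rcases le_total (n : ℝ) t with h | h
  · rw [min_eq_left h, abs_of_nonneg this]
    exact h.trans (le_abs_self t)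
  · rw [min_eq_right h]

lemma integrable_min [IsProbabilityMeasure P] (hX : Measurable X) (t : ℝ) :
    Integrable (fun ω => min (X ω : ℝ) t) P := by
  refine Integrable.of_bound (C := |t|) ?_ (ae_of_all _ fun ω => abs_min_natCast_le _ _)
  have : Measurable fun ω => (X ω : ℝ) := measurable_from_nat.comp hX
  exact (this.min measurable_const).aestronglyMeasurable

lemma truncatedMean_mono [IsProbabilityMeasure P] (hX : Measurable X) :
    Monotone (truncatedMean P X) := fun _ _ h =>
  integral_mono (integrable_min hX _) (integrable_min hX _) fun _ => min_le_min_left _ h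

lemma truncatedMean_natCast [IsProbabilityMeasure P] (hX : Measurable X) (n : ℕ) :
    truncatedMean P X n = tailSum (genSeries P X) n := by
  have e : ∀ k m : ℕ, min (k : ℝ) m = ∑ i ∈ Finset.range m, if i < k then (1 : ℝ) else 0 := by
    intro k m
    rw [← Finset.sum_filter, Finset.sum_const, nsmul_eq_mul, mul_one, ← Nat.cast_min]
    congr 1
    have : (Finset.range m).filter (fun i => i < k) = Finset.range (min k m) := by
      ext; simp; omega
    rw [this, Finset.card_range]
  have hm : ∀ i : ℕ, MeasurableSet {ω | i < X ω} := fun i => hX measurableSet_Ioi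
  have e2 : ∀ i : ℕ, (fun ω => if i < X ω then (1 : ℝ) else 0) =
      Set.indicator {ω | i < X ω} 1 := by
    intro i; ext ω; simp [Set.indicator_apply]
  simp_rw [truncatedMean, e, tailSum, coeff_genSeries, sum_range_real_eq hX]
  rw [integral_finsetSum]
  · refine Finset.sum_congr rfl fun i _ => ?_
    rw [e2, integral_indicator_one (hm i)]
    have : {ω | i < X ω} = {ω | X ω < i + 1}ᶜ := by ext ω; simp
    have hc : MeasurableSet {ω | X ω < i + 1} := hX measurableSet_Iio
    rw [this, probReal_compl_eq_one_sub hc]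
  · intro i _
    rw [e2]
    exact (integrable_const (1 : ℝ)).indicator (hm i)

/-- Dominated convergence, with bound 1. This makes the 1 in `1 + a n` negligible. -/
lemma tendsto_truncatedMean_div [IsProbabilityMeasure P] (hX : Measurable X) :
    Tendsto (fun n : ℕ => truncatedMean P X n / n) atTop (𝓝 0) := by
  have h : Tendsto (fun n : ℕ => ∫ ω, min (X ω : ℝ) n / n ∂P) atTop (𝓝 (∫ _, (0 : ℝ) ∂P)) := by
    refine tendsto_integral_of_dominated_convergence (fun _ => 1) ?_ (integrable_const 1) ?_ ?_
    · intro n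
      exact ((integrable_min hX n).div_const _).aestronglyMeasurable
    · intro n
      refine ae_of_all _ fun ω => ?_
      rw [Real.norm_eq_abs, abs_div]
      exact div_le_one_of_le₀ (abs_min_natCast_le _ _) (abs_nonneg _)
    · refine ae_of_all _ fun ω => ?_
      refine squeeze_zero (g := fun n : ℕ => (X ω : ℝ) / n) (fun n => by positivity) (fun n => ?_)
        (tendsto_const_div_atTop_nhds_zero_nat _)
      gcongr
      exact min_le_left _ _
  simp only [integral_zero] at h
  refine h.congr fun n => ?_
  rw [integral_div, truncatedMean]

end Lifetimes

end Renewal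

/-! ### Consequences of slow variation -/

namespace Renewal

/-- Iterating the inequality `j` times bounds the upper limit by `ρ ^ j * C`. -/
lemma tendsto_zero_of_contraction {x e : ℕ → ℝ} {φ : ℕ → ℕ} {ρ C : ℝ} (hx0 : ∀ n, 0 ≤ x n)
    (hxC : ∀ n, x n ≤ C) (hφ : Tendsto φ atTop atTop) (hρ0 : 0 ≤ ρ) (hρ1 : ρ < 1)
    (he : Tendsto e atTop (𝓝 0)) (hx : ∀ᶠ n in atTop, x n ≤ ρ * x (φ n) + e n) :
    Tendsto x atTop (𝓝 0) := by
  have key : ∀ j : ℕ, ∀ ε > 0, ∀ᶠ n in atTop, x n < ρ ^ j * C + ε := by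
    intro j
    induction j with
    | zero =>
      intro ε hε
      exact Eventually.of_forall fun n => by linarith [hxC n, pow_zero ρ]
    | succ j ih =>
      intro ε hε
      filter_upwards [hx, hφ.eventually (ih (ε / 2) (by linarith)),
        he.eventually (gt_mem_nhds (by linarith : (0 : ℝ) < ε / 2))] with n h1 h2 h3
      have h4 := mul_le_mul_of_nonneg_left h2.le hρ0
      rw [pow_succ]
      nlinarith
  refine tendsto_order.2 ⟨fun b hb => Eventually.of_forall fun n => hb.trans_le (hx0 n),
    fun b hb => ?_⟩
  have ht : Tendsto (fun j : ℕ => ρ ^ j * C) atTop (𝓝 (0 * C)) :=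
    (tendsto_pow_atTop_nhds_zero_of_lt_one hρ0 hρ1).mul_const C
  rw [zero_mul] at ht
  obtain ⟨j, hj⟩ := (ht.eventually (gt_mem_nhds (by linarith : (0 : ℝ) < b / 2))).exists
  filter_upwards [key j (b / 2) (by linarith)] with n hn
  linarith

section Asymptotics

variable {a : ℕ → ℝ} {ℓ : ℝ → ℝ}

lemma tendsto_ratio_natCast (hslow : ∀ c : ℝ, 0 < c → Tendsto (fun t => ℓ (c * t) / ℓ t) atTop (𝓝 1))
    {c : ℝ} (hc : 0 < c) : Tendsto (fun n : ℕ => ℓ n / ℓ (c * n)) atTop (𝓝 1) := by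
  have h := ((hslow c hc).comp tendsto_natCast_atTop_atTop).inv₀ one_ne_zero
  rw [inv_one] at h
  exact h.congr fun n => by simp

lemma eventually_pos_natCast_mul (hpos : ∀ᶠ t in atTop, 0 < ℓ t) {c : ℝ} (hc : 0 < c) :
    ∀ᶠ n : ℕ in atTop, 0 < ℓ (c * n) :=
  (tendsto_natCast_atTop_atTop.const_mul_atTop hc).eventually hpos

lemma tendsto_mul_div_of_bounds (hpos : ∀ᶠ t in atTop, 0 < ℓ t)
    (hslow : ∀ c : ℝ, 0 < c → Tendsto (fun t => ℓ (c * t) / ℓ t) atTop (𝓝 1))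
    (hdiv : Tendsto (fun n : ℕ => ℓ n / n) atTop (𝓝 0))
    (hlow : ∀ n : ℕ, (n : ℝ) ≤ (1 + a n) * ℓ n)
    (hup : ∀ (n : ℕ) (t : ℝ), 0 ≤ t → (1 + a n) * ℓ t ≤ n + (t + 1)) :
    Tendsto (fun n : ℕ => a n * ℓ n / n) atTop (𝓝 1) := by
  have hposn : ∀ᶠ n : ℕ in atTop, 0 < ℓ n := tendsto_natCast_atTop_atTop.eventually hpos
  refine tendsto_order.2 ⟨fun b hb => ?_, fun b hb => ?_⟩
  · filter_upwards [hdiv.eventually (gt_mem_nhds (by linarith : (0 : ℝ) < 1 - b)),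
      eventually_gt_atTop 0] with n h1 h2
    have hn : (0 : ℝ) < n := Nat.cast_pos.2 h2
    rw [div_lt_iff₀ hn] at h1
    rw [lt_div_iff₀ hn]
    linarith [hlow n]
  · obtain ⟨ε, hε, hεb⟩ : ∃ ε > 0, 1 + ε < b := ⟨(b - 1) / 2, by linarith, by linarith⟩
    have hlim : Tendsto (fun n : ℕ => (1 + ε + 1 / (n : ℝ)) * (ℓ n / ℓ (ε * n))) atTop
        (𝓝 ((1 + ε + 0) * 1)) :=
      (tendsto_one_div_atTop_nhds_zero_nat.const_add _).mul (tendsto_ratio_natCast hslow hε)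
    filter_upwards [hlim.eventually (gt_mem_nhds (by linarith : (1 + ε + 0) * 1 < b)),
      eventually_gt_atTop 0, hposn, eventually_pos_natCast_mul hpos hε] with n h1 h2 h3 h4
    have hn : (0 : ℝ) < n := Nat.cast_pos.2 h2
    refine lt_of_le_of_lt ?_ h1
    have h5 := hup n (ε * n) (by positivity)
    have h6 : (1 + a n) ≤ (n + (ε * n + 1)) / ℓ (ε * n) := by rwa [le_div_iff₀ h4]
    calc a n * ℓ n / n ≤ (1 + a n) * ℓ n / n := by gcongr; linarith
      _ ≤ (n + (ε * n + 1)) / ℓ (ε * n) * ℓ n / n := by gcongr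
      _ = _ := by
        generalize ℓ (ε * n) = y at h4
        field_simp
        ring

lemma eventually_pos_of_tendsto (hpos : ∀ᶠ t in atTop, 0 < ℓ t)
    (ha : Tendsto (fun n : ℕ => a n * ℓ n / n) atTop (𝓝 1)) : ∀ᶠ n in atTop, 0 < a n := by
  filter_upwards [ha.eventually (lt_mem_nhds zero_lt_one), eventually_gt_atTop 0,
    tendsto_natCast_atTop_atTop.eventually hpos] with n h1 h2 h3
  have hn : (0 : ℝ) < n := Nat.cast_pos.2 h2
  by_contra hneg
  have := mul_nonpos_of_nonpos_of_nonneg (not_lt.1 hneg) h3.le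
  linarith [div_nonpos_of_nonpos_of_nonneg this hn.le]

lemma tendsto_moment_gap {S : ℕ → ℝ} (hpos : ∀ᶠ t in atTop, 0 < ℓ t)
    (hslow : ∀ c : ℝ, 0 < c → Tendsto (fun t => ℓ (c * t) / ℓ t) atTop (𝓝 1))
    (ha : Tendsto (fun n : ℕ => a n * ℓ n / n) atTop (𝓝 1))
    (hS : ∀ (n : ℕ) (t : ℝ), 0 ≤ t →
      S n * ℓ t ^ 2 ≤ (n : ℝ) ^ 2 / 2 + 2 * n * (t + 1) + (t + 1) ^ 2)
    (hS0 : ∀ n, 0 ≤ S n - a n ^ 2 / 2) :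
    Tendsto (fun n => (S n - a n ^ 2 / 2) / a n ^ 2) atTop (𝓝 0) := by
  refine tendsto_order.2 ⟨fun b hb => Eventually.of_forall fun n =>
    hb.trans_le (div_nonneg (hS0 n) (sq_nonneg _)), fun b hb => ?_⟩
  obtain ⟨ε, hε, hεb⟩ : ∃ ε > 0, 2 * ε + ε ^ 2 < b := by
    refine ⟨min (b / 4) 1, by positivity, ?_⟩
    have h1 := min_le_left (b / 4) 1
    have h2 := min_le_right (b / 4) 1
    have h3 : 0 < min (b / 4) 1 := by positivity
    nlinarith
  have hinv : Tendsto (fun n : ℕ => (a n * ℓ n / n)⁻¹) atTop (𝓝 1) := by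
    simpa using ha.inv₀ one_ne_zero
  have hc : Tendsto (fun n : ℕ => ε + 1 / (n : ℝ)) atTop (𝓝 (ε + 0)) :=
    tendsto_one_div_atTop_nhds_zero_nat.const_add _
  have hlim : Tendsto (fun n : ℕ => (1 / 2 + 2 * (ε + 1 / (n : ℝ)) + (ε + 1 / (n : ℝ)) ^ 2) *
      ((a n * ℓ n / n)⁻¹) ^ 2 * (ℓ n / ℓ (ε * n)) ^ 2) atTop
      (𝓝 ((1 / 2 + 2 * (ε + 0) + (ε + 0) ^ 2) * 1 ^ 2 * 1 ^ 2)) :=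
    ((((hc.const_mul 2).const_add _).add (hc.pow 2)).mul (hinv.pow 2)).mul
      ((tendsto_ratio_natCast hslow hε).pow 2)
  filter_upwards [hlim.eventually (gt_mem_nhds (show
      (1 / 2 + 2 * (ε + 0) + (ε + 0) ^ 2) * 1 ^ 2 * 1 ^ 2 < 1 / 2 + b by linarith)),
    eventually_gt_atTop 0, tendsto_natCast_atTop_atTop.eventually hpos,
    eventually_pos_natCast_mul hpos hε, eventually_pos_of_tendsto hpos ha] with n h1 h2 h3 h4 h5
  have hn : (0 : ℝ) < n := Nat.cast_pos.2 h2
  have h6 := hS n (ε * n) (by positivity)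
  have h7 : S n ≤ ((n : ℝ) ^ 2 / 2 + 2 * n * (ε * n + 1) + (ε * n + 1) ^ 2) / ℓ (ε * n) ^ 2 := by
    rwa [le_div_iff₀ (by positivity)]
  have h8 : S n / a n ^ 2 ≤ (1 / 2 + 2 * (ε + 1 / (n : ℝ)) + (ε + 1 / (n : ℝ)) ^ 2) *
      ((a n * ℓ n / n)⁻¹) ^ 2 * (ℓ n / ℓ (ε * n)) ^ 2 := by
    calc S n / a n ^ 2 ≤ ((n : ℝ) ^ 2 / 2 + 2 * n * (ε * n + 1) + (ε * n + 1) ^ 2) /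
          ℓ (ε * n) ^ 2 / a n ^ 2 := by gcongr
      _ = _ := by
        generalize ℓ (ε * n) = y at h4
        field_simp
  have h9 : (S n - a n ^ 2 / 2) / a n ^ 2 = S n / a n ^ 2 - 1 / 2 := by field_simp
  rw [h9]; linarith

lemma tendsto_ratio_floor (hmono : Monotone ℓ) (hpos : ∀ᶠ t in atTop, 0 < ℓ t)
    (hslow : ∀ c : ℝ, 0 < c → Tendsto (fun t => ℓ (c * t) / ℓ t) atTop (𝓝 1))
    (ha : Tendsto (fun n : ℕ => a n * ℓ n / n) atTop (𝓝 1)) {ρ : ℝ} (hρ0 : 0 < ρ) (hρ1 : ρ ≤ 1) :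
    Tendsto (fun n : ℕ => a ⌊ρ * n⌋₊ / a n) atTop (𝓝 ρ) := by
  have hφ : Tendsto (fun n : ℕ => ⌊ρ * n⌋₊) atTop atTop :=
    tendsto_nat_floor_atTop.comp (tendsto_natCast_atTop_atTop.const_mul_atTop hρ0)
  have hposn : ∀ᶠ n : ℕ in atTop, 0 < ℓ n := tendsto_natCast_atTop_atTop.eventually hpos
  have hfl : Tendsto (fun n : ℕ => (⌊ρ * n⌋₊ : ℝ) / n) atTop (𝓝 ρ) :=
    (tendsto_nat_floor_mul_div_atTop hρ0.le).comp tendsto_natCast_atTop_atTop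
  -- Slow variation concerns a fixed factor; monotonicity handles the floor, which lies between `ρ n
  -- / 2` and `n` once `ρ n / 2 ≥ 1`.
  have hℓ : Tendsto (fun n : ℕ => ℓ n / ℓ ⌊ρ * n⌋₊) atTop (𝓝 1) := by
    refine tendsto_of_tendsto_of_tendsto_of_le_of_le' tendsto_const_nhds
      (tendsto_ratio_natCast hslow (half_pos hρ0)) ?_ ?_
    · filter_upwards [hφ.eventually hposn] with n h1
      rw [one_le_div h1]
      refine hmono ((Nat.floor_le (by positivity)).trans ?_)
      nlinarith [n.cast_nonneg (α := ℝ)]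
    · filter_upwards [eventually_pos_natCast_mul hpos (half_pos hρ0), hposn,
        (tendsto_natCast_atTop_atTop.const_mul_atTop (half_pos hρ0)).eventually
          (eventually_ge_atTop (1 : ℝ))] with n h1 h2 h3
      have := hmono (show ρ / 2 * (n : ℝ) ≤ ⌊ρ * n⌋₊ by linarith [Nat.lt_floor_add_one (ρ * n)])
      gcongr
  have hlim := (((ha.comp hφ).mul (ha.inv₀ one_ne_zero)).mul hfl).mul hℓ
  rw [inv_one, mul_one, mul_one, one_mul] at hlim
  refine hlim.congr' ?_
  filter_upwards [hφ.eventually hposn, hposn, eventually_gt_atTop 0,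
    hφ.eventually (eventually_gt_atTop 0), eventually_pos_of_tendsto hpos ha] with n h1 h2 h3 h4 h5
  have hn : (0 : ℝ) < n := Nat.cast_pos.2 h3
  have hm : (0 : ℝ) < ⌊ρ * n⌋₊ := Nat.cast_pos.2 h4
  simp only [Function.comp_apply]
  field_simp

end Asymptotics

end Renewal

/-! ### Concentration of the number of renewals near the return sequence -/

namespace Renewal

open PowerSeries Finset

/-- The part of the renewal sequence at `n` carried by numbers of renewals `k` that are not within
relative distance `δ` of the return sequence. -/
noncomputable def deviantMass (F : ℝ⟦X⟧) (δ : ℝ) (n : ℕ) : ℝ :=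
  ∑ k ∈ (Icc 1 n).filter fun k : ℕ => ¬ |(k : ℝ) - seriesReturn F n| < δ * seriesReturn F n,
    coeff n (F ^ k)

/-- The excess of the first moment of `k ↦ seriesDist F k n` over its least possible value. -/
noncomputable def momentGap (F : ℝ⟦X⟧) (n : ℕ) : ℝ :=
  ∑ k ∈ Icc 1 n, (k : ℝ) * seriesDist F k n - seriesReturn F n ^ 2 / 2

variable {F : ℝ⟦X⟧}

lemma seriesDist_nonneg (h : ∀ n, 0 ≤ coeff n F) (k n : ℕ) : 0 ≤ seriesDist F k n :=
  sum_nonneg fun _ _ => coeff_pow_nonneg h _ _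

lemma deviantMass_nonneg (h : ∀ n, 0 ≤ coeff n F) (δ : ℝ) (n : ℕ) : 0 ≤ deviantMass F δ n :=
  sum_nonneg fun _ _ => coeff_pow_nonneg h _ _

lemma deviantMass_le (h : ∀ n, 0 ≤ coeff n F) (δ : ℝ) (n : ℕ) :
    deviantMass F δ n ≤ seriesRenewal F n :=
  sum_le_sum_of_subset_of_nonneg (filter_subset _ _) fun _ _ _ => coeff_pow_nonneg h _ _

lemma seriesReturn_le (h0 : constantCoeff F = 0) (hd : ∀ k n, seriesDist F k n ≤ 1) (n : ℕ) :
    seriesReturn F n ≤ n := by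
  rw [seriesReturn_eq_sum_dist h0]
  calc ∑ k ∈ Icc 1 n, seriesDist F k n ≤ ∑ k ∈ Icc 1 n, (1 : ℝ) := sum_le_sum fun k _ => hd k n
    _ = n := by simp

lemma lower_tail_mul_le (h0 : constantCoeff F = 0) (h : ∀ n, 0 ≤ coeff n F)
    (hd : ∀ k n, seriesDist F k n ≤ 1) {η : ℝ} (hη : 0 ≤ η) (n : ℕ) :
    (∑ k ∈ (Icc 1 n).filter fun k : ℕ => (k : ℝ) ≤ (1 - η) * seriesReturn F n,
      (1 - seriesDist F k n)) * (η * seriesReturn F n) ≤ momentGap F n := by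
  have h1 := sum_tails_le (η := η) (fun k => seriesDist_nonneg h k n) (fun k => hd k n)
    (seriesReturn_eq_sum_dist h0 n).symm hη
  have h2 : 0 ≤ (∑ k ∈ (Icc 1 n).filter fun k : ℕ => (1 + η) * seriesReturn F n < (k : ℝ),
      seriesDist F k n) * (η * seriesReturn F n) :=
    mul_nonneg (sum_nonneg fun k _ => seriesDist_nonneg h k n)
      (mul_nonneg hη (seriesReturn_nonneg h n))
  unfold momentGap
  linarith

lemma upper_tail_mul_le (h0 : constantCoeff F = 0) (h : ∀ n, 0 ≤ coeff n F)
    (hd : ∀ k n, seriesDist F k n ≤ 1) {η : ℝ} (hη : 0 ≤ η) (n : ℕ) :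
    (∑ k ∈ (Icc 1 n).filter fun k : ℕ => (1 + η) * seriesReturn F n < (k : ℝ),
      seriesDist F k n) * (η * seriesReturn F n) ≤ momentGap F n := by
  have h1 := sum_tails_le (η := η) (fun k => seriesDist_nonneg h k n) (fun k => hd k n)
    (seriesReturn_eq_sum_dist h0 n).symm hη
  have h2 : 0 ≤ (∑ k ∈ (Icc 1 n).filter fun k : ℕ => (k : ℝ) ≤ (1 - η) * seriesReturn F n,
      (1 - seriesDist F k n)) * (η * seriesReturn F n) :=
    mul_nonneg (sum_nonneg fun k _ => sub_nonneg.2 (hd k n))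
      (mul_nonneg hη (seriesReturn_nonneg h n))
  unfold momentGap
  linarith

lemma momentGap_nonneg (h0 : constantCoeff F = 0) (h : ∀ n, 0 ≤ coeff n F)
    (hd : ∀ k n, seriesDist F k n ≤ 1) (n : ℕ) : 0 ≤ momentGap F n := by
  simpa using lower_tail_mul_le h0 h hd le_rfl n

lemma sum_Ioc_coeff_pow (F : ℝ⟦X⟧) (k : ℕ) {M N : ℕ} (hMN : M ≤ N) :
    ∑ n ∈ Ioc M N, coeff n (F ^ k) = seriesDist F k N - seriesDist F k M := by
  have : Ioc M N = Ico (M + 1) (N + 1) := by ext; simp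
  rw [this, sum_Ico_eq_sub _ (by omega)]
  rfl

/-- Between `M` and `N` the deviant mass is controlled by the two tails. -/
lemma sum_Ioc_deviantMass_le (h0 : constantCoeff F = 0) (h : ∀ n, 0 ≤ coeff n F)
    (hd : ∀ k n, seriesDist F k n ≤ 1) {δ : ℝ} (hδ0 : 0 < δ) (hδ1 : δ < 1 / 2) {M N : ℕ}
    (hMN : M ≤ N) (hM : 0 < seriesReturn F M)
    (hr : (1 - δ / 2) * seriesReturn F N ≤ seriesReturn F M) :
    ∑ n ∈ Ioc M N, deviantMass F δ n ≤
      momentGap F M / (δ / 4 * seriesReturn F M) + momentGap F N / (δ / 4 * seriesReturn F N) := by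
  have hN : 0 < seriesReturn F N := hM.trans_le (seriesReturn_mono h hMN)
  set S := (Icc 1 M).filter fun k : ℕ => (k : ℝ) ≤ (1 - δ / 4) * seriesReturn F M with hS
  set T := (Icc 1 N).filter fun k : ℕ => (1 + δ / 4) * seriesReturn F N < (k : ℝ) with hT
  have hpt : ∀ n ∈ Ioc M N, deviantMass F δ n ≤
      ∑ k ∈ S, coeff n (F ^ k) + ∑ k ∈ T, coeff n (F ^ k) := by
    intro n hn
    have hn' := mem_Ioc.1 hn
    have a1 := seriesReturn_mono h hn'.1.le
    have a2 := seriesReturn_mono h hn'.2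
    have a3 := seriesReturn_le h0 hd M
    rw [← sum_union_inter]
    have h3 : 0 ≤ ∑ k ∈ S ∩ T, coeff n (F ^ k) := sum_nonneg fun _ _ => coeff_pow_nonneg h _ _
    refine le_trans ?_ (le_add_of_nonneg_right h3)
    refine sum_le_sum_of_subset_of_nonneg ?_ fun _ _ _ => coeff_pow_nonneg h _ _
    intro k hk
    rw [mem_filter, mem_Icc, not_lt, le_abs] at hk
    obtain ⟨⟨k1, k2⟩, k3 | k3⟩ := hk
    · refine mem_union_right _ (mem_filter.2 ⟨mem_Icc.2 ⟨k1, k2.trans hn'.2⟩, ?_⟩)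
      -- Too many renewals: `(1 + δ) (1 - δ/2) > 1 + δ/4` precisely because `0 < δ < 1/2`.
      have e1 : (1 + δ) * seriesReturn F M ≤ k := by nlinarith
      have e2 : (1 + δ) * ((1 - δ / 2) * seriesReturn F N) ≤ (1 + δ) * seriesReturn F M := by gcongr
      have e3 : (1 + δ / 4) * seriesReturn F N < (1 + δ) * (1 - δ / 2) * seriesReturn F N := by
        gcongr; nlinarith
      linarith
    · have e1 : (k : ℝ) ≤ (1 - δ) * seriesReturn F N := by nlinarith
      have e2 : (1 - δ) * seriesReturn F N ≤ (1 - δ / 4) * (1 - δ / 2) * seriesReturn F N := by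
        gcongr; nlinarith
      have e3 : (1 - δ / 4) * ((1 - δ / 2) * seriesReturn F N) ≤
          (1 - δ / 4) * seriesReturn F M := by
        gcongr; linarith
      have e4 : (k : ℝ) ≤ (1 - δ / 4) * seriesReturn F M := by linarith
      refine mem_union_left _ (mem_filter.2 ⟨mem_Icc.2 ⟨k1, ?_⟩, e4⟩)
      -- Membership in `Icc 1 M` follows from `seriesReturn F M ≤ M`, not from `k ≤ n`.
      have : (k : ℝ) ≤ M := by nlinarith
      exact_mod_cast this
  calc ∑ n ∈ Ioc M N, deviantMass F δ n
      ≤ ∑ n ∈ Ioc M N, (∑ k ∈ S, coeff n (F ^ k) + ∑ k ∈ T, coeff n (F ^ k)) := sum_le_sum hpt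
    _ = ∑ k ∈ S, (seriesDist F k N - seriesDist F k M) +
        ∑ k ∈ T, (seriesDist F k N - seriesDist F k M) := by
        rw [sum_add_distrib, sum_comm, sum_comm (t := T)]
        simp_rw [sum_Ioc_coeff_pow F _ hMN]
    _ ≤ ∑ k ∈ S, (1 - seriesDist F k M) + ∑ k ∈ T, seriesDist F k N := by
        gcongr with k _ k _
        · exact hd k N
        · linarith [seriesDist_nonneg h k M]
    _ ≤ _ := by
        gcongr
        · rw [le_div_iff₀ (by positivity)]
          exact lower_tail_mul_le h0 h hd (by positivity) M
        · rw [le_div_iff₀ (by positivity)]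
          exact upper_tail_mul_le h0 h hd (by positivity) N

/-- The deviant mass is negligible in Cesàro mean relative to the return sequence. -/
lemma tendsto_sum_deviantMass_div {ℓ : ℝ → ℝ} (h0 : constantCoeff F = 0)
    (h : ∀ n, 0 ≤ coeff n F) (hd : ∀ k n, seriesDist F k n ≤ 1)
    (hmono : Monotone ℓ) (hpos : ∀ᶠ t in atTop, 0 < ℓ t)
    (hslow : ∀ c : ℝ, 0 < c → Tendsto (fun t => ℓ (c * t) / ℓ t) atTop (𝓝 1))
    (ha : Tendsto (fun n : ℕ => seriesReturn F n * ℓ n / n) atTop (𝓝 1))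
    (hgap : Tendsto (fun n => momentGap F n / seriesReturn F n ^ 2) atTop (𝓝 0))
    {δ : ℝ} (hδ0 : 0 < δ) (hδ1 : δ < 1 / 2) :
    Tendsto (fun N => (∑ n ∈ Icc 1 N, deviantMass F δ n) / seriesReturn F N) atTop (𝓝 0) := by
  have hφ : Tendsto (fun n : ℕ => ⌊(1 - δ / 4) * (n : ℝ)⌋₊) atTop atTop :=
    tendsto_nat_floor_atTop.comp
      (tendsto_natCast_atTop_atTop.const_mul_atTop (by linarith : 0 < 1 - δ / 4))
  have hratio := tendsto_ratio_floor hmono hpos hslow ha (by linarith : 0 < 1 - δ / 4)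
    (by linarith)
  have hapos := eventually_pos_of_tendsto hpos ha
  have he : Tendsto (fun n : ℕ => 4 / δ *
      (momentGap F ⌊(1 - δ / 4) * (n : ℝ)⌋₊ / seriesReturn F ⌊(1 - δ / 4) * (n : ℝ)⌋₊ ^ 2 +
        momentGap F n / seriesReturn F n ^ 2)) atTop (𝓝 0) := by
    simpa using ((hgap.comp hφ).add hgap).const_mul (4 / δ)
  -- The limit ratio `1 - δ/4` lies strictly between `1 - δ/2`, required by the block estimate, and
  -- the contraction factor `1 - δ/8`.
  refine tendsto_zero_of_contraction (C := 1) (ρ := 1 - δ / 8)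
    (φ := fun n : ℕ => ⌊(1 - δ / 4) * (n : ℝ)⌋₊) ?_ ?_ hφ (by linarith) (by linarith) he ?_
  · exact fun n => div_nonneg (sum_nonneg fun _ _ => deviantMass_nonneg h _ _)
      (seriesReturn_nonneg h n)
  · exact fun n => div_le_one_of_le₀ (sum_le_sum fun k _ => deviantMass_le h δ k)
      (seriesReturn_nonneg h n)
  · filter_upwards [hapos, hφ.eventually hapos,
      hratio.eventually (gt_mem_nhds (by linarith : 1 - δ / 4 < 1 - δ / 8)),
      hratio.eventually (lt_mem_nhds (by linarith : 1 - δ / 2 < 1 - δ / 4))] with N h1 h2 h3 h4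
    set M := ⌊(1 - δ / 4) * (N : ℝ)⌋₊ with hM
    have hMN : M ≤ N := by
      refine Nat.floor_le_of_le ?_
      nlinarith [N.cast_nonneg (α := ℝ)]
    rw [lt_div_iff₀ h1] at h4
    have h5 := sum_Ioc_deviantMass_le h0 h hd hδ0 hδ1 hMN h2 h4.le
    have h6 : ∑ n ∈ Icc 1 N, deviantMass F δ n =
        ∑ n ∈ Icc 1 M, deviantMass F δ n + ∑ n ∈ Ioc M N, deviantMass F δ n := by
      exact (sum_Ioc_consecutive (deviantMass F δ) (Nat.zero_le M) hMN).symm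
    have hB : 0 ≤ ∑ n ∈ Icc 1 M, deviantMass F δ n :=
      sum_nonneg fun _ _ => deviantMass_nonneg h _ _
    have hG := momentGap_nonneg h0 h hd M
    have h7 : seriesReturn F M ≤ seriesReturn F N := seriesReturn_mono h hMN
    rw [h6]
    calc _ ≤ (∑ n ∈ Icc 1 M, deviantMass F δ n + (momentGap F M / (δ / 4 * seriesReturn F M) +
            momentGap F N / (δ / 4 * seriesReturn F N))) / seriesReturn F N := by gcongr
      _ = (seriesReturn F M / seriesReturn F N) *
            ((∑ n ∈ Icc 1 M, deviantMass F δ n) / seriesReturn F M) +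
            4 / δ * (momentGap F M / (seriesReturn F M * seriesReturn F N) +
              momentGap F N / seriesReturn F N ^ 2) := by field_simp
      _ ≤ _ := by
        rw [sq (seriesReturn F M)]
        gcongr

/-- Testing a bounded function that is nearly constant near `1`. -/
lemma sum_abs_test_sub_le (h : ∀ n, 0 ≤ coeff n F) {g : ℝ → ℝ} {C ε δ : ℝ}
    (hC : ∀ x, 0 < x → |g x| ≤ C) (hε : 0 ≤ ε)
    (hg : ∀ x, |x - 1| < δ → |g x - g 1| ≤ ε) (n : ℕ) :
    |(∑ k ∈ Icc 1 n, g ((k : ℝ) / seriesReturn F n) * coeff n (F ^ k)) - g 1 * seriesRenewal F n| ≤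
      ε * seriesRenewal F n + 2 * C * deviantMass F δ n := by
  have hC0 : 0 ≤ C := (abs_nonneg _).trans (hC 1 one_pos)
  rcases eq_or_ne n 0 with rfl | hn
  · simp [seriesRenewal, deviantMass]
  have hu : seriesRenewal F n ≤ seriesReturn F n :=
    single_le_sum (f := seriesRenewal F) (fun i _ => seriesRenewal_nonneg h i)
      (mem_Icc.2 ⟨Nat.one_le_iff_ne_zero.2 hn, le_rfl⟩)
  rw [deviantMass, sum_filter, seriesRenewal, mul_sum, ← sum_sub_distrib, mul_sum, mul_sum,
    ← sum_add_distrib]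
  refine (abs_sum_le_sum_abs _ _).trans (sum_le_sum fun k hk => ?_)
  have hc := coeff_pow_nonneg h k n
  rw [← sub_mul, abs_mul, abs_of_nonneg hc]
  -- If the return sequence vanishes at `n`, so does every coefficient here, and the value of `g` at
  -- `k / 0 = 0` is irrelevant.
  rcases (seriesReturn_nonneg h n).eq_or_lt with ha | ha
  · have h1 : coeff n (F ^ k) ≤ seriesRenewal F n :=
      single_le_sum (f := fun k => coeff n (F ^ k)) (fun i _ => coeff_pow_nonneg h i n) hk
    have h2 : coeff n (F ^ k) = 0 := by linarith
    simp [h2]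
  · split_ifs with hb
    · have h1 : |(k : ℝ) / seriesReturn F n - 1| < δ := by
        rw [div_sub_one ha.ne', abs_div, abs_of_pos ha, div_lt_iff₀ ha]
        exact hb
      have := hg _ h1
      nlinarith
    · have hk0 : (0 : ℝ) < k := Nat.cast_pos.2 (mem_Icc.1 hk).1
      have h1 : |g ((k : ℝ) / seriesReturn F n) - g 1| ≤ 2 * C := by
        have := abs_sub (g ((k : ℝ) / seriesReturn F n)) (g 1)
        linarith [hC _ (div_pos hk0 ha), hC 1 one_pos]
      nlinarith

lemma tendsto_sum_abs_test {g : ℝ → ℝ} {C : ℝ} (h : ∀ n, 0 ≤ coeff n F)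
    (hapos : ∀ᶠ n in atTop, 0 < seriesReturn F n)
    (hdev : ∀ δ : ℝ, 0 < δ → δ < 1 / 2 →
      Tendsto (fun N => (∑ n ∈ Icc 1 N, deviantMass F δ n) / seriesReturn F N) atTop (𝓝 0))
    (hC : ∀ x, 0 < x → |g x| ≤ C) (hg : ContinuousAt g 1) :
    Tendsto (fun N : ℕ => (1 / seriesReturn F N) * ∑ n ∈ Icc 1 N,
      |(∑ k ∈ Icc 1 n, g ((k : ℝ) / seriesReturn F n) * coeff n (F ^ k))
        - g 1 * seriesRenewal F n|) atTop (𝓝 0) := by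
  refine tendsto_order.2 ⟨fun b hb => Eventually.of_forall fun n => hb.trans_le
    (mul_nonneg (one_div_nonneg.2 (seriesReturn_nonneg h n)) (sum_nonneg fun _ _ => abs_nonneg _)),
    fun b hb => ?_⟩
  obtain ⟨δ₀, hδ₀, hδg⟩ := Metric.continuousAt_iff.1 hg (b / 2) (half_pos hb)
  have hδ : 0 < min δ₀ (1 / 4) := by positivity
  have hlim := (hdev _ hδ ((min_le_right _ _).trans_lt (by norm_num))).const_mul (2 * C)
  rw [mul_zero] at hlim
  filter_upwards [hapos, hlim.eventually (gt_mem_nhds (half_pos hb))] with N h1 h2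
  have h3 : ∑ n ∈ Icc 1 N, |(∑ k ∈ Icc 1 n, g ((k : ℝ) / seriesReturn F n) * coeff n (F ^ k))
        - g 1 * seriesRenewal F n| ≤ b / 2 * seriesReturn F N +
          2 * C * ∑ n ∈ Icc 1 N, deviantMass F (min δ₀ (1 / 4)) n := by
    rw [seriesReturn, mul_sum, mul_sum, ← sum_add_distrib]
    refine sum_le_sum fun n _ => sum_abs_test_sub_le h hC (half_pos hb).le (fun x hx => ?_) n
    exact (hδg (hx.trans_le (min_le_left _ _))).le
  calc _ ≤ 1 / seriesReturn F N * (b / 2 * seriesReturn F N +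
          2 * C * ∑ n ∈ Icc 1 N, deviantMass F (min δ₀ (1 / 4)) n) := by gcongr
    _ = b / 2 + 2 * C * ((∑ n ∈ Icc 1 N, deviantMass F (min δ₀ (1 / 4)) n) /
          seriesReturn F N) := by field_simp
    _ < b := by linarith

end Renewal

/-! ### The theorem -/

theorem corollary7 {Ω : Type*} [MeasurableSpace Ω] (P : Measure Ω) [IsProbabilityMeasure P]
    (ξ : ℕ → Ω → ℕ) (hmeas : ∀ i, Measurable (ξ i)) (hpos : ∀ i, ∀ᵐ ω ∂P, 1 ≤ ξ i ω)
    (hindep : iIndepFun ξ P) (hident : ∀ i, IdentDistrib (ξ i) (ξ 0) P P)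
    (hslow : IsSlowlyVarying (Renewal.truncatedMean P (ξ 0))) :
    ((fun n : ℕ => Renewal.returnSeq P ξ n) ~[atTop]
      fun n : ℕ => (n : ℝ) / Renewal.truncatedMean P (ξ 0) (n : ℝ)) ∧
    ∀ g : ℝ → ℝ, ContinuousOn g (Set.Ioi 0) → (∃ C : ℝ, ∀ x, 0 < x → |g x| ≤ C) →
      Tendsto (fun N : ℕ => (1 / Renewal.returnSeq P ξ N) *
          ∑ n ∈ Finset.Icc 1 N,
            |(∑ k ∈ Finset.Icc 1 n,
                g ((k : ℝ) / Renewal.returnSeq P ξ n) * Renewal.hitProb P ξ k n)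
              - g 1 * Renewal.renewalSeq P ξ n|)
        atTop (𝓝 0) := by
  obtain ⟨⟨A, -, hA⟩, hslow⟩ := hslow
  set F := Renewal.genSeries P (ξ 0) with hF
  set ℓ := Renewal.truncatedMean P (ξ 0) with hℓ
  have hit : ∀ k n, Renewal.hitProb P ξ k n = PowerSeries.coeff n (F ^ k) :=
    Renewal.hitProb_eq_coeff hmeas hindep hident
  have hren : ∀ n, Renewal.renewalSeq P ξ n = Renewal.seriesRenewal F n := fun n => by
    simp_rw [Renewal.renewalSeq, hit, Renewal.seriesRenewal]
  have hret : ∀ n, Renewal.returnSeq P ξ n = Renewal.seriesReturn F n := fun n => by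
    simp_rw [Renewal.returnSeq, hren, Renewal.seriesReturn]
  simp_rw [hret, hren, hit]
  have h0 : PowerSeries.constantCoeff F = 0 := Renewal.constantCoeff_genSeries (hpos 0)
  have h : ∀ n, 0 ≤ PowerSeries.coeff n F := Renewal.coeff_genSeries_nonneg
  have h1 := Renewal.sum_coeff_genSeries_le_one (P := P) (hmeas 0)
  have hd := Renewal.seriesDist_genSeries_le_one hmeas hindep hident
  have hmono : Monotone ℓ := Renewal.truncatedMean_mono (hmeas 0)
  have hℓpos : ∀ᶠ t in atTop, 0 < ℓ t := (eventually_ge_atTop A).mono hA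
  have hℓnat : ∀ n : ℕ, ℓ n = Renewal.tailSum F n := Renewal.truncatedMean_natCast (hmeas 0)
  have hup : ∀ (n : ℕ) (t : ℝ), 0 ≤ t →
      (1 + Renewal.seriesReturn F n) * ℓ t ≤ n + (t + 1) := by
    intro n t ht
    -- Rounding `t` up to an integer passes from the integer bound to real truncation levels.
    have e1 : ℓ t ≤ Renewal.tailSum F (⌊t⌋₊ + 1) := by
      rw [← hℓnat]
      exact hmono (by push_cast; exact (Nat.lt_floor_add_one t).le)
    have e2 := Renewal.seriesReturn_nonneg h n
    calc _ ≤ (1 + Renewal.seriesReturn F n) * Renewal.tailSum F (⌊t⌋₊ + 1) := by gcongr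
      _ ≤ n + ⌊t⌋₊ + 1 := Renewal.seriesReturn_upper h0 h h1 n _
      _ ≤ n + (t + 1) := by linarith [Nat.floor_le ht]
  have ha := Renewal.tendsto_mul_div_of_bounds hℓpos hslow
    (Renewal.tendsto_truncatedMean_div (hmeas 0))
    (fun n => by rw [hℓnat]; exact Renewal.seriesReturn_lower h0 h h1 n) hup
  have hℓ0 : ∀ t : ℝ, 0 ≤ t → 0 ≤ ℓ t := fun t ht =>
    integral_nonneg fun ω => le_min (Nat.cast_nonneg _) ht
  have hgap := Renewal.tendsto_moment_gap hℓpos hslow ha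
    (fun n t ht => Renewal.sum_mul_seriesDist_le h0 h (hℓ0 t ht) (by linarith)
      (fun n => hup n t ht) n)
    (Renewal.momentGap_nonneg h0 h hd)
  refine ⟨?_, fun g hg ⟨C, hC⟩ => ?_⟩
  · refine (isEquivalent_iff_tendsto_one ?_).2 (ha.congr fun n => ?_)
    · filter_upwards [tendsto_natCast_atTop_atTop.eventually hℓpos, eventually_gt_atTop 0]
        with n e1 e2
      exact (div_pos (Nat.cast_pos.2 e2) e1).ne'
    · simp [div_div_eq_mul_div]
  · exact Renewal.tendsto_sum_abs_test h (Renewal.eventually_pos_of_tendsto hℓpos ha)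
      (fun δ hδ0 hδ1 => Renewal.tendsto_sum_deviantMass_div h0 h hd hmono hℓpos hslow ha hgap hδ0 hδ1)
      hC (hg.continuousAt (Ioi_mem_nhds one_pos))
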